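/- **Proposition.** Let $F\subset\mathbb C$ be a compact set whose transfinite diameter $$c(F)=\lim_{n\to\infty}\ \sup_{x_1,\dots,x_n\in F}\ \prod_{i\neq j}|x_i-x_j|^{\frac1{n(n-1)}}$$ is positive. Let $\lambda:\mathbb C\to\mathbb R$ be a logarithmic distance function for $F$, that is, a continuous function with $\lambda(z)=0$ for $z\in F$, $\lambda(z)>0$ for $z\notin F$, and such that $|\lambda(z)-\log^+|z||$ is bounded on $\mathbb C$. Let $(S_n)$ be a sequence of finite subsets of $\mathbb C$ that is pseudo-equidistributed with respect to the pair $(F,\lambda)$; that is, with $N_n=\#S_n$, $$\lim_{n\to\infty}\frac1{N_n}\sum_{z\in S_n}\lambda(z)=0,\qquad \lim_{n\to\infty}N_n=\infty,\qquad \lim_{n\to\infty}\ \prod_{\substack{x,y\in S_n\\ x\ne y}}|x-y|^{\frac1{N_n(N_n-1)}}=c(F).$$ Then there is a unique Borel probability measure $\mu_F$ supported on $F$ (the equilibrium measure of $F$) whose energy $\iint -\log|x-y|\,d\mu(x)\,d\mu(y)\in(-\infty,+\infty]$ is minimal among all Borel probability measures $\mu$ supported on $F$, and $(S_n)$ is equidistributed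 with respect to $\mu_F$: for every bounded continuous $f:\mathbb C\to\mathbb R$, $$\lim_{n\to\infty}\frac1{N_n}\sum_{z\in S_n}f(z)=\int f\,d\mu_F .$$ -/

import Mathlib

open MeasureTheory Filter Topology
open scoped ENNReal BoundedContinuousFunction

noncomputable section

namespace LogPotential

/-! ### Transfinite diameter -/

section Metric

variable {M : Type*} [MetricSpace M]

/-- The geometric mean of the distances `d(x i, x j)`, `i ≠ j`, of an `n`-tuple of points. -/
def tupleMean {n : ℕ} (x : Fin n → M) : ℝ≥0∞ :=
  ∏ p ∈ (Finset.univ : Finset (Fin n)).offDiag,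
    edist (x p.1) (x p.2) ^ (((n : ℝ) * ((n : ℝ) - 1))⁻¹)

/-- The `n`th diameter of `A`: the supremum over all `n`-tuples of points of `A` of the
geometric mean of their pairwise distances. It is taken in `[0, ∞]`, so that it is a genuine
supremum for unbounded `A` too. -/
def nthDiameter (n : ℕ) (A : Set M) : ℝ≥0∞ :=
  ⨆ x : Fin n → A, tupleMean (fun i => (x i : M))

/-- The transfinite diameter `c(A) = lim_n d_n(A)`; see `tendsto_nthDiameter` for the existence
of the limit. -/
def transfiniteDiameter (A : Set M) : ℝ≥0∞ :=
  limUnder atTop (fun n : ℕ => nthDiameter n A)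

/-- The geometric mean of the distances `d(x, y)` over ordered pairs of distinct points of a
finite set. -/
def finsetMean (S : Finset M) : ℝ≥0∞ :=
  ∏ p ∈ S.offDiag, edist p.1 p.2 ^ (((S.card : ℝ) * ((S.card : ℝ) - 1))⁻¹)

lemma prod_offDiag_succAbove {n : ℕ} (k : Fin (n + 1)) (g : Fin (n + 1) × Fin (n + 1) → ℝ≥0∞) :
    ∏ p ∈ (Finset.univ : Finset (Fin n)).offDiag, g (k.succAbove p.1, k.succAbove p.2) =
      ∏ p ∈ (Finset.univ : Finset (Fin (n + 1))).offDiag with k ≠ p.1 ∧ k ≠ p.2, g p := by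
  refine Finset.prod_bij (fun p _ => (k.succAbove p.1, k.succAbove p.2)) ?_ ?_ ?_ ?_
  · rintro ⟨a, b⟩ h
    simp only [Finset.mem_offDiag, Finset.mem_univ, true_and, Finset.mem_filter] at h ⊢
    exact ⟨fun h' => h (Fin.succAbove_right_injective h'),
      (Fin.succAbove_ne k a).symm, (Fin.succAbove_ne k b).symm⟩
  · rintro ⟨a, b⟩ _ ⟨a', b'⟩ _ h
    simp only [Prod.mk.injEq] at h
    exact Prod.ext (Fin.succAbove_right_injective h.1) (Fin.succAbove_right_injective h.2)
  · rintro ⟨a, b⟩ h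
    simp only [Finset.mem_offDiag, Finset.mem_univ, true_and, Finset.mem_filter] at h
    obtain ⟨a', rfl⟩ := Fin.exists_succAbove_eq h.2.1.symm
    obtain ⟨b', rfl⟩ := Fin.exists_succAbove_eq h.2.2.symm
    refine ⟨(a', b'), ?_, rfl⟩
    simp only [Finset.mem_offDiag, Finset.mem_univ, true_and]
    rintro rfl
    exact h.1 rfl
  · rintro ⟨a, b⟩ _
    rfl

lemma prod_prod_succAbove {n : ℕ} (g : Fin (n + 1) × Fin (n + 1) → ℝ≥0∞) :
    ∏ k : Fin (n + 1), ∏ p ∈ (Finset.univ : Finset (Fin n)).offDiag,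
        g (k.succAbove p.1, k.succAbove p.2) =
      (∏ p ∈ (Finset.univ : Finset (Fin (n + 1))).offDiag, g p) ^ (n - 1) := by
  simp_rw [prod_offDiag_succAbove, Finset.prod_filter]
  rw [Finset.prod_comm, ← Finset.prod_pow]
  refine Finset.prod_congr rfl ?_
  rintro ⟨a, b⟩ h
  simp only [Finset.mem_offDiag, Finset.mem_univ, true_and] at h
  rw [← Finset.prod_filter, Finset.prod_const]
  congr 1
  have : (Finset.univ.filter fun k : Fin (n + 1) => k ≠ a ∧ k ≠ b) =
      (Finset.univ.erase a).erase b := by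
    ext k
    simp [and_comm]
  rw [this, Finset.card_erase_of_mem (by simp [Ne.symm h]), Finset.card_erase_of_mem (by simp)]
  simp

lemma nthDiameter_succ_le {n : ℕ} (hn : 2 ≤ n) (A : Set M) :
    nthDiameter (n + 1) A ≤ nthDiameter n A := by
  refine iSup_le fun x => ?_
  have hn' : (2 : ℝ) ≤ n := by exact_mod_cast hn
  have hm : 0 < (n : ℝ) * ((n : ℝ) - 1) := by nlinarith
  have hm' : 0 < ((n + 1 : ℕ) : ℝ) * (((n + 1 : ℕ) : ℝ) - 1) := by push_cast; nlinarith
  set P : ℝ≥0∞ := ∏ p ∈ (Finset.univ : Finset (Fin (n + 1))).offDiag,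
    edist (x p.1 : M) (x p.2) with hP
  have h1 : tupleMean (fun i => (x i : M)) = P ^ ((((n + 1 : ℕ) : ℝ) * (((n + 1 : ℕ) : ℝ) - 1))⁻¹) := by
    unfold tupleMean
    rw [ENNReal.prod_rpow_of_nonneg (inv_nonneg.2 hm'.le)]
  have h2 : ∀ k : Fin (n + 1), (∏ p ∈ (Finset.univ : Finset (Fin n)).offDiag,
      edist (x (k.succAbove p.1) : M) (x (k.succAbove p.2))) ≤
        nthDiameter n A ^ ((n : ℝ) * ((n : ℝ) - 1)) := by
    intro k
    have h3 : tupleMean (fun i => (x (k.succAbove i) : M)) ≤ nthDiameter n A :=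
      le_iSup (fun y : Fin n → A => tupleMean (fun i => (y i : M))) (fun i => x (k.succAbove i))
    unfold tupleMean at h3
    rw [ENNReal.prod_rpow_of_nonneg (inv_nonneg.2 hm.le)] at h3
    exact (ENNReal.rpow_inv_le_iff hm).1 h3
  have h4 := Finset.prod_le_prod' fun k (_ : k ∈ (Finset.univ : Finset (Fin (n + 1)))) => h2 k
  rw [prod_prod_succAbove (fun p => edist (x p.1 : M) (x p.2)), ← hP, Finset.prod_const,
    Finset.card_univ, Fintype.card_fin, ← ENNReal.rpow_natCast, ← ENNReal.rpow_natCast,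
    ← ENNReal.rpow_mul, Nat.cast_sub (by omega)] at h4
  rw [h1, ENNReal.rpow_inv_le_iff hm']
  have hk : 0 < (n : ℝ) - 1 := by linarith
  have h5 := ENNReal.rpow_le_rpow h4 (inv_nonneg.2 hk.le)
  rw [← ENNReal.rpow_mul, ← ENNReal.rpow_mul] at h5
  have e1 : ((n : ℝ) - (1 : ℕ)) * ((n : ℝ) - 1)⁻¹ = 1 := by
    push_cast
    exact mul_inv_cancel₀ hk.ne'
  have e2 : (n : ℝ) * ((n : ℝ) - 1) * ((n + 1 : ℕ) : ℝ) * ((n : ℝ) - 1)⁻¹ =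
      ((n + 1 : ℕ) : ℝ) * (((n + 1 : ℕ) : ℝ) - 1) := by
    push_cast
    field_simp
    ring
  rwa [e1, e2, ENNReal.rpow_one] at h5

/-- The limit that defines the transfinite diameter exists. -/
theorem tendsto_nthDiameter (A : Set M) :
    Tendsto (fun n : ℕ => nthDiameter n A) atTop (𝓝 (transfiniteDiameter A)) := by
  refine tendsto_nhds_limUnder ?_
  have h : Antitone fun n : ℕ => nthDiameter (n + 2) A :=
    antitone_nat_of_succ_le fun n => nthDiameter_succ_le (by omega) A
  exact ⟨_, (tendsto_add_atTop_iff_nat 2).1 (tendsto_atTop_iInf h)⟩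

end Metric

/-! ### Energy and equilibrium measure -/

/-- The logarithmic energy `∬ -log |x - y| dμ(x) dμ(y)` of a Borel measure on `ℂ`, as an
extended real: the integral of the positive part minus that of the negative part of the kernel,
which is `+∞` on the diagonal (`ENNReal.log 0 = ⊥`). For a finite measure carried by a bounded set
the second integral is finite. -/
def energy (μ : Measure ℂ) : EReal :=
  ((∫⁻ x, ∫⁻ y, (-ENNReal.log (edist x y)).toENNReal ∂μ ∂μ : ℝ≥0∞) : EReal) -
    ((∫⁻ x, ∫⁻ y, (ENNReal.log (edist x y)).toENNReal ∂μ ∂μ : ℝ≥0∞) : EReal)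

/-- `μ` is an equilibrium measure of `F`: a Borel probability measure carried by `F` whose energy
is minimal among all such measures. -/
structure IsEquilibriumMeasure (F : Set ℂ) (μ : Measure ℂ) : Prop where
  isProbabilityMeasure : IsProbabilityMeasure μ
  compl_null : μ Fᶜ = 0
  energy_le : ∀ ν : Measure ℂ, IsProbabilityMeasure ν → ν Fᶜ = 0 → energy μ ≤ energy ν

/-! ### Equidistribution and pseudo-equidistribution -/

/-- The uniform measure `(1 / #S) ∑_{z ∈ S} δ_z` on a finite set. -/
def uniformMeasure (S : Finset ℂ) : Measure ℂ :=
  (S.card : ℝ≥0∞)⁻¹ • ∑ z ∈ S, Measure.dirac z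

/-- The uniform measures on the sets `S n` converge weakly to `μ`. -/
def IsEquidistributed (S : ℕ → Finset ℂ) (μ : Measure ℂ) : Prop :=
  ∀ f : ℂ →ᵇ ℝ, Tendsto (fun n => ∫ z, f z ∂(uniformMeasure (S n))) atTop (𝓝 (∫ z, f z ∂μ))

/-- `lam` is a logarithmic distance function for `F`. Here `Real.posLog t = max 0 (log t)`. -/
structure IsLogDistance (F : Set ℂ) (lam : ℂ → ℝ) : Prop where
  continuous : Continuous lam
  eq_zero : ∀ z ∈ F, lam z = 0
  pos : ∀ z, z ∉ F → 0 < lam z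
  bounded : ∃ C : ℝ, ∀ z, |lam z - Real.posLog ‖z‖| ≤ C

/-- The average value of `lam` on `S n` tends to zero. -/
def IsTaut (lam : ℂ → ℝ) (S : ℕ → Finset ℂ) : Prop :=
  Tendsto (fun n => ((S n).card : ℝ)⁻¹ * ∑ z ∈ S n, lam z) atTop (𝓝 0)

/-- `S` is a generalized Fekete sequence for `F`. -/
structure IsGeneralizedFekete (F : Set ℂ) (S : ℕ → Finset ℂ) : Prop where
  card : Tendsto (fun n => (S n).card) atTop atTop
  mean : Tendsto (fun n => finsetMean (S n)) atTop (𝓝 (transfiniteDiameter F))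

/-- `S` is pseudo-equidistributed with respect to the pair `(F, lam)`. -/
structure IsPseudoEquidistributed (F : Set ℂ) (lam : ℂ → ℝ) (S : ℕ → Finset ℂ) : Prop where
  taut : IsTaut lam S
  fekete : IsGeneralizedFekete F S

end LogPotential

end

noncomputable section

namespace LogPotential


/-! The minimal energy on $F$ is $-\log c(F)$, and every weak limit of the uniform measures on the
$S_n$ attains it. Lower bound (`ofReal_log_sub_log_le_mutualEnergy`): the mean of $-\log|x_i-x_j|$
over pairs of an $n$-tuple in $F$ is at least minus the log of the $n$th diameter; integrate this
against $\nu^{\otimes n}$ and let $n\to\infty$. Upper bound (`mutualEnergy_le_of_tendsto`): tautness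
puts the limit on $F$, and the kernel $\lambda(x)+\lambda(y)-\log|x-y|$, truncated near the
diagonal, is bounded and continuous on all of $\mathbb C^2$, so its double averages pass to the
limit. The Fekete condition bounds them by $-\log c(F)$, and Fatou removes the truncation.
Uniqueness (`IsEquilibriumMeasure.eq_of_mutualEnergy_ne_top`): the energy is strictly convex,
because the logarithmic kernel is, up to a constant, a superposition of Gaussians, which are
strictly positive definite by Fourier analysis. Tautness also gives tightness. By Prokhorov limit
points exist; they all equal the unique minimizer, hence the whole sequence converges. -/

/-! ### The energy as an integral of a nonnegative kernel -/

/-- The kernel `log (R / |x - y|)`, truncated below at `0`, with value `∞` on the diagonal. -/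
def logKernel (R : ℝ) (x y : ℂ) : ℝ≥0∞ :=
  if x = y then ⊤ else ENNReal.ofReal (Real.log (R / dist x y))

/-- The mutual energy of two measures with respect to `logKernel R`. -/
def mutualEnergy (R : ℝ) (μ ν : Measure ℂ) : ℝ≥0∞ :=
  ∫⁻ x, ∫⁻ y, logKernel R x y ∂ν ∂μ

lemma logKernel_self (R : ℝ) (x : ℂ) : logKernel R x x = ⊤ := by simp [logKernel]

lemma logKernel_of_ne {R : ℝ} (hR : 0 < R) {x y : ℂ} (h : x ≠ y) :
    logKernel R x y = ENNReal.ofReal (Real.log R - Real.log (dist x y)) := by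
  rw [logKernel, if_neg h, Real.log_div hR.ne' (dist_pos.2 h).ne']

lemma measurable_logKernel (R : ℝ) : Measurable fun p : ℂ × ℂ => logKernel R p.1 p.2 := by
  unfold logKernel
  refine Measurable.ite ?_ measurable_const (by fun_prop)
  exact measurableSet_eq_fun measurable_fst measurable_snd

lemma log_edist_of_ne {x y : ℂ} (h : x ≠ y) :
    ENNReal.log (edist x y) = (Real.log (dist x y) : ℝ) := by
  rw [edist_dist, ENNReal.log_ofReal_of_pos (dist_pos.2 h)]

/-- Stated with sums only, so that no subtraction occurs in `ℝ≥0∞` and the diagonal is included,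
where both sides are `⊤`. -/
lemma neg_log_edist_add {R : ℝ} (hR : 1 ≤ R) {x y : ℂ} (hxy : dist x y ≤ R) :
    (-ENNReal.log (edist x y)).toENNReal + ENNReal.ofReal (Real.log R) =
      (ENNReal.log (edist x y)).toENNReal + logKernel R x y := by
  have hR0 : 0 < R := by linarith
  by_cases h : x = y
  · subst h
    simp [logKernel_self]
  · rw [logKernel_of_ne hR0 h, log_edist_of_ne h, ← EReal.coe_neg, EReal.real_coe_toENNReal,
      EReal.real_coe_toENNReal]
    have h1 : Real.log (dist x y) ≤ Real.log R := Real.log_le_log (dist_pos.2 h) hxy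
    have h2 : 0 ≤ Real.log R := Real.log_nonneg hR
    rcases le_total 0 (Real.log (dist x y)) with h3 | h3
    · rw [ENNReal.ofReal_of_nonpos (by linarith), zero_add,
        ← ENNReal.ofReal_add h3 (by linarith)]
      congr 1
      ring
    · rw [ENNReal.ofReal_of_nonpos h3, zero_add, ← ENNReal.ofReal_add (by linarith) h2]
      congr 1
      ring

lemma measurable_log_edist : Measurable fun p : ℂ × ℂ => ENNReal.log (edist p.1 p.2) :=
  ENNReal.measurable_log.comp (by fun_prop)

/-- On a set of diameter at most `R` the energy is the energy for `logKernel R`, up to the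
constant `log R`. -/
lemma energy_eq {F : Set ℂ} {R : ℝ} (hR : 1 ≤ R) (hF : ∀ x ∈ F, ∀ y ∈ F, dist x y ≤ R)
    {μ : Measure ℂ} [IsProbabilityMeasure μ] (hμ : μ Fᶜ = 0) :
    energy μ = (mutualEnergy R μ μ : EReal) - (Real.log R : ℝ) := by
  have hae : ∀ᵐ x ∂μ, x ∈ F := by
    rw [ae_iff]
    exact hμ
  set P := ∫⁻ x, ∫⁻ y, (-ENNReal.log (edist x y)).toENNReal ∂μ ∂μ with hP
  set N := ∫⁻ x, ∫⁻ y, (ENNReal.log (edist x y)).toENNReal ∂μ ∂μ with hN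
  have mN : Measurable fun p : ℂ × ℂ => (ENNReal.log (edist p.1 p.2)).toENNReal :=
    measurable_log_edist.ereal_toENNReal
  have mP : Measurable fun p : ℂ × ℂ => (-ENNReal.log (edist p.1 p.2)).toENNReal :=
    measurable_log_edist.neg.ereal_toENNReal
  have key : P + ENNReal.ofReal (Real.log R) = N + mutualEnergy R μ μ := by
    have e1 : P + ENNReal.ofReal (Real.log R) =
        ∫⁻ x, ∫⁻ y, ((-ENNReal.log (edist x y)).toENNReal + ENNReal.ofReal (Real.log R)) ∂μ ∂μ := by
      simp_rw [lintegral_add_right _ measurable_const, lintegral_const, measure_univ, mul_one]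
      exact hP.symm ▸ rfl
    have e2 : N + mutualEnergy R μ μ =
        ∫⁻ x, ∫⁻ y, ((ENNReal.log (edist x y)).toENNReal + logKernel R x y) ∂μ ∂μ := by
      rw [hN, mutualEnergy, ← lintegral_add_left mN.lintegral_prod_right']
      refine lintegral_congr fun x => ?_
      exact (lintegral_add_left (mN.comp measurable_prodMk_left) _).symm
    rw [e1, e2]
    refine lintegral_congr_ae ?_
    filter_upwards [hae] with x hx
    refine lintegral_congr_ae ?_
    filter_upwards [hae] with y hy
    exact neg_log_edist_add hR (hF x hx y hy)
  -- Finiteness of the negative part allows `key` to be solved for `P - N`; it holds because the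
  -- distances are at most `R`.
  have hNtop : N ≠ ⊤ := by
    refine ne_top_of_le_ne_top (b := ENNReal.ofReal (Real.log R)) ENNReal.ofReal_ne_top ?_
    calc N ≤ ∫⁻ _, ∫⁻ _, ENNReal.ofReal (Real.log R) ∂μ ∂μ := by
          refine lintegral_mono_ae ?_
          filter_upwards [hae] with x hx
          refine lintegral_mono_ae ?_
          filter_upwards [hae] with y hy
          rw [← EReal.real_coe_toENNReal]
          refine EReal.toENNReal_le_toENNReal ?_
          rcases eq_or_ne x y with rfl | h
          · simp
          · rw [log_edist_of_ne h]
            exact_mod_cast Real.log_le_log (dist_pos.2 h) (hF x hx y hy)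
      _ = _ := by simp
  have hl : ((ENNReal.ofReal (Real.log R) : ℝ≥0∞) : EReal) = (Real.log R : ℝ) := by
    rw [EReal.coe_ennreal_ofReal, max_eq_left (Real.log_nonneg hR)]
  rw [energy, ← hP, ← hN, ← hl]
  generalize mutualEnergy R μ μ = I at key ⊢
  have hℓ : ENNReal.ofReal (Real.log R) ≠ ⊤ := ENNReal.ofReal_ne_top
  generalize ENNReal.ofReal (Real.log R) = ℓ at key hℓ ⊢
  clear_value P N
  lift N to NNReal using hNtop
  lift ℓ to NNReal using hℓ
  induction P with
  | top =>
    have : I = ⊤ := by simpa [eq_comm] using key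
    subst this
    rfl
  | coe P =>
    have : I ≠ ⊤ := by
      rintro rfl
      exact absurd key (by simp [← ENNReal.coe_add])
    lift I to NNReal using this
    have key' : (P : ℝ) + ℓ = N + I := by exact_mod_cast key
    have e : ∀ a : NNReal, (((a : ℝ≥0∞)) : EReal) = ((a : ℝ) : EReal) := fun _ => rfl
    rw [e, e, e, e, ← EReal.coe_sub, ← EReal.coe_sub]
    congr 1
    linarith

/-- Both energies are shifted by the same finite constant $\log R$, so minimality can be tested in
`ℝ≥0∞`. -/
lemma energy_le_energy_iff {F : Set ℂ} {R : ℝ} (hR : 1 ≤ R)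
    (hF : ∀ x ∈ F, ∀ y ∈ F, dist x y ≤ R) {μ ν : Measure ℂ} [IsProbabilityMeasure μ]
    [IsProbabilityMeasure ν] (hμ : μ Fᶜ = 0) (hν : ν Fᶜ = 0) :
    energy μ ≤ energy ν ↔ mutualEnergy R μ μ ≤ mutualEnergy R ν ν := by
  rw [energy_eq hR hF hμ, energy_eq hR hF hν, sub_eq_add_neg, sub_eq_add_neg, ← EReal.coe_neg,
    ← EReal.coe_ennreal_le_coe_ennreal_iff]
  constructor
  · intro h
    have := add_le_add_left h ((Real.log R : ℝ) : EReal)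
    rw [add_assoc, add_assoc, ← EReal.coe_add, neg_add_cancel, EReal.coe_zero, add_zero,
      add_zero] at this
    exact this
  · intro h
    exact add_le_add_left h _


/-! ### The logarithm as a Frullani integral of Gaussians -/

lemma lintegral_exp_neg_mul_Ioi {s : ℝ} (hs : 0 < s) :
    ∫⁻ t in Set.Ioi (0 : ℝ), ENNReal.ofReal (Real.exp (-t * s)) = ENNReal.ofReal s⁻¹ := by
  have hi : IntegrableOn (fun t : ℝ => Real.exp (-t * s)) (Set.Ioi 0) := by
    simpa [mul_comm] using integrableOn_exp_mul_Ioi (neg_lt_zero.2 hs) 0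
  rw [← ofReal_integral_eq_lintegral_ofReal hi (ae_of_all _ fun t => (Real.exp_pos _).le)]
  have := integral_exp_mul_Ioi (neg_lt_zero.2 hs) 0
  simp only [mul_zero, Real.exp_zero, neg_div_neg_eq, one_div] at this
  rw [← this]
  congr 2
  ext t
  ring_nf

lemma ofReal_exp_sub_exp_div {a b t : ℝ} (hab : a ≤ b) (ht : 0 < t) :
    ENNReal.ofReal ((Real.exp (-t * a) - Real.exp (-t * b)) / t) =
      ∫⁻ s in Set.Ioc a b, ENNReal.ofReal (Real.exp (-t * s)) := by
  have hc : Continuous fun s : ℝ => Real.exp (-t * s) := by fun_prop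
  rw [← ofReal_integral_eq_lintegral_ofReal
    ((hc.intervalIntegrable a b).1) (ae_of_all _ fun s => (Real.exp_pos _).le),
    ← intervalIntegral.integral_of_le hab,
    intervalIntegral.integral_eq_sub_of_hasDerivAt (f := fun s => -Real.exp (-t * s) / t)
      (fun s _ => ?_) (hc.intervalIntegrable a b)]
  · congr 1
    ring
  · have h := (((hasDerivAt_id s).const_mul (-t)).exp.neg).div_const t
    convert! h using 1
    simp only [id, mul_one]
    field_simp

/-- The Frullani integral of the exponential function, as a Lebesgue integral. -/
lemma lintegral_exp_sub_exp_div {a b : ℝ} (ha : 0 ≤ a) (hab : a ≤ b) :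
    ∫⁻ t in Set.Ioi (0 : ℝ), ENNReal.ofReal ((Real.exp (-t * a) - Real.exp (-t * b)) / t) =
      ∫⁻ s in Set.Ioc a b, ENNReal.ofReal s⁻¹ := by
  rw [setLIntegral_congr_fun measurableSet_Ioi fun t ht => ofReal_exp_sub_exp_div hab ht,
    lintegral_lintegral_swap
      (Measurable.aemeasurable (by unfold Function.uncurry; fun_prop))]
  exact setLIntegral_congr_fun measurableSet_Ioc fun s hs =>
    lintegral_exp_neg_mul_Ioi (ha.trans_lt hs.1)

lemma lintegral_Ioc_inv {a b : ℝ} (ha : 0 < a) (hab : a ≤ b) :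
    ∫⁻ s in Set.Ioc a b, ENNReal.ofReal s⁻¹ = ENNReal.ofReal (Real.log (b / a)) := by
  have hi : IntervalIntegrable (fun s : ℝ => s⁻¹) volume a b := by
    rw [intervalIntegrable_inv_iff, Set.uIcc_of_le hab]
    exact Or.inr fun h => h.1.not_gt ha
  rw [← integral_inv_of_pos ha (ha.trans_le hab), intervalIntegral.integral_of_le hab,
    ofReal_integral_eq_lintegral_ofReal hi.1]
  filter_upwards [ae_restrict_mem measurableSet_Ioc] with s hs
  exact inv_nonneg.2 (ha.trans hs.1).le

/-- This divergence matches the value `⊤` of `logKernel` on the diagonal. -/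
lemma lintegral_Ioc_zero_inv {b : ℝ} (hb : 0 < b) :
    ∫⁻ s in Set.Ioc 0 b, ENNReal.ofReal s⁻¹ = ⊤ := by
  by_contra h
  have hi : IntervalIntegrable (fun s : ℝ => s⁻¹) volume 0 b := by
    rw [intervalIntegrable_iff_integrableOn_Ioc_of_le hb.le]
    refine ⟨measurable_inv.aestronglyMeasurable, ?_⟩
    rw [hasFiniteIntegral_iff_ofReal]
    · exact lt_top_iff_ne_top.2 h
    · filter_upwards [ae_restrict_mem measurableSet_Ioc] with s hs
      exact inv_nonneg.2 hs.1.le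
  rw [intervalIntegrable_inv_iff] at hi
  simp [hb.ne, hb.le] at hi

/-- The logarithmic kernel as a superposition of Gaussian kernels. -/
lemma two_mul_logKernel {R : ℝ} (hR : 0 < R) {x y : ℂ} (h : dist x y ≤ R) :
    2 * logKernel R x y = ∫⁻ t in Set.Ioi (0 : ℝ),
      ENNReal.ofReal ((Real.exp (-t * dist x y ^ 2) - Real.exp (-t * R ^ 2)) / t) := by
  -- Frullani with endpoints $|x-y|^2$ and $R^2$; the squares produce the factor 2.
  rw [lintegral_exp_sub_exp_div (sq_nonneg _) (pow_le_pow_left₀ dist_nonneg h 2)]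
  rcases eq_or_ne x y with rfl | hxy
  · rw [logKernel_self, dist_self, zero_pow two_ne_zero, lintegral_Ioc_zero_inv (by positivity)]
    simp
  · have hd := dist_pos.2 hxy
    rw [lintegral_Ioc_inv (by positivity) (pow_le_pow_left₀ dist_nonneg h 2), ← div_pow,
      Real.log_pow, logKernel, if_neg hxy, ENNReal.ofReal_mul (by norm_num)]
    simp

/-! ### Positive definiteness of the Gaussian kernel -/

/-- The mutual energy of two measures with respect to the Gaussian kernel `exp (-t |x - y|²)`. -/
def gaussianEnergy (t : ℝ) (μ ν : Measure ℂ) : ℝ :=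
  ∫ p, Real.exp (-t * dist p.1 p.2 ^ 2) ∂(μ.prod ν)

lemma mutualEnergy_eq_lintegral_prod (R : ℝ) (μ ν : Measure ℂ) [SFinite ν] :
    mutualEnergy R μ ν = ∫⁻ p, logKernel R p.1 p.2 ∂(μ.prod ν) :=
  (lintegral_prod _ (measurable_logKernel R).aemeasurable).symm

lemma logKernel_comm (R : ℝ) (x y : ℂ) : logKernel R x y = logKernel R y x := by
  simp only [logKernel, eq_comm, dist_comm]

lemma mutualEnergy_comm (R : ℝ) (μ ν : Measure ℂ) [SFinite μ] [SFinite ν] :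
    mutualEnergy R μ ν = mutualEnergy R ν μ := by
  rw [mutualEnergy, lintegral_lintegral_swap (measurable_logKernel R).aemeasurable]
  simp_rw [logKernel_comm R _ _]
  rfl

lemma integrable_exp_neg_mul_dist_sq {t : ℝ} (ht : 0 ≤ t) (ρ : Measure (ℂ × ℂ))
    [IsFiniteMeasure ρ] : Integrable (fun p : ℂ × ℂ => Real.exp (-t * dist p.1 p.2 ^ 2)) ρ := by
  refine Integrable.of_bound (C := 1) (Continuous.aestronglyMeasurable (by fun_prop))
    (ae_of_all _ fun p => ?_)
  rw [Real.norm_of_nonneg (Real.exp_pos _).le, Real.exp_le_one_iff]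
  nlinarith [mul_nonneg ht (sq_nonneg (dist p.1 p.2))]

lemma ae_prod_mem {F : Set ℂ} {μ ν : Measure ℂ} [SFinite μ] [SFinite ν]
    (hμ : μ Fᶜ = 0) (hν : ν Fᶜ = 0) : ∀ᵐ p ∂(μ.prod ν), p.1 ∈ F ∧ p.2 ∈ F := by
  have h1 : ∀ᵐ x ∂μ, x ∈ F := hμ
  have h2 : ∀ᵐ x ∂ν, x ∈ F := hν
  exact (Measure.quasiMeasurePreserving_fst.ae h1).and (Measure.quasiMeasurePreserving_snd.ae h2)

/-- Almost all pairs lie at distance at most `R`, so the integrand is nonnegative and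
`ENNReal.ofReal` loses nothing; the subtracted constant integrates to itself against a probability
measure. -/
lemma lintegral_gaussian_sub {F : Set ℂ} {R : ℝ}
    (hF : ∀ x ∈ F, ∀ y ∈ F, dist x y ≤ R) {μ ν : Measure ℂ} [IsProbabilityMeasure μ]
    [IsProbabilityMeasure ν] (hμ : μ Fᶜ = 0) (hν : ν Fᶜ = 0) {t : ℝ} (ht : 0 < t) :
    0 ≤ gaussianEnergy t μ ν - Real.exp (-t * R ^ 2) ∧
    ∫⁻ p, ENNReal.ofReal ((Real.exp (-t * dist p.1 p.2 ^ 2) - Real.exp (-t * R ^ 2)) / t)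
      ∂(μ.prod ν) = ENNReal.ofReal ((gaussianEnergy t μ ν - Real.exp (-t * R ^ 2)) / t) := by
  have hi := integrable_exp_neg_mul_dist_sq ht.le (μ.prod ν)
  have hnn : 0 ≤ᵐ[μ.prod ν] fun p : ℂ × ℂ =>
      Real.exp (-t * dist p.1 p.2 ^ 2) - Real.exp (-t * R ^ 2) := by
    filter_upwards [ae_prod_mem hμ hν] with p hp
    have h := pow_le_pow_left₀ dist_nonneg (hF _ hp.1 _ hp.2) 2
    refine sub_nonneg.2 (Real.exp_le_exp.2 ?_)
    nlinarith
  have e : ∫ p, (Real.exp (-t * dist p.1 p.2 ^ 2) - Real.exp (-t * R ^ 2)) ∂(μ.prod ν) =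
      gaussianEnergy t μ ν - Real.exp (-t * R ^ 2) := by
    rw [integral_sub hi (integrable_const _), gaussianEnergy]
    simp
  refine ⟨e ▸ integral_nonneg_of_ae hnn, ?_⟩
  rw [← e, ← integral_div]
  refine (ofReal_integral_eq_lintegral_ofReal
    ((hi.sub (integrable_const _)).div_const t) ?_).symm
  filter_upwards [hnn] with p hp using div_nonneg hp ht.le

lemma measurable_gaussian_sub (R : ℝ) : Measurable fun q : (ℂ × ℂ) × ℝ =>
    ENNReal.ofReal ((Real.exp (-q.2 * dist q.1.1 q.1.2 ^ 2) - Real.exp (-q.2 * R ^ 2)) / q.2) := by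
  fun_prop

lemma two_mul_mutualEnergy {F : Set ℂ} {R : ℝ} (hR : 0 < R)
    (hF : ∀ x ∈ F, ∀ y ∈ F, dist x y ≤ R) {μ ν : Measure ℂ} [IsProbabilityMeasure μ]
    [IsProbabilityMeasure ν] (hμ : μ Fᶜ = 0) (hν : ν Fᶜ = 0) :
    2 * mutualEnergy R μ ν = ∫⁻ t in Set.Ioi (0 : ℝ),
      ENNReal.ofReal ((gaussianEnergy t μ ν - Real.exp (-t * R ^ 2)) / t) := by
  rw [mutualEnergy_eq_lintegral_prod, ← lintegral_const_mul _ (measurable_logKernel R)]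
  have : ∀ᵐ p ∂(μ.prod ν), 2 * logKernel R p.1 p.2 = ∫⁻ t in Set.Ioi (0 : ℝ),
      ENNReal.ofReal ((Real.exp (-t * dist p.1 p.2 ^ 2) - Real.exp (-t * R ^ 2)) / t) := by
    filter_upwards [ae_prod_mem hμ hν] with p hp using two_mul_logKernel hR (hF _ hp.1 _ hp.2)
  rw [lintegral_congr_ae this,
    lintegral_lintegral_swap (measurable_gaussian_sub R).aemeasurable]
  exact setLIntegral_congr_fun measurableSet_Ioi fun t ht =>
    (lintegral_gaussian_sub hF hμ hν ht).2

lemma measurable_gaussianEnergy (μ ν : Measure ℂ) [IsProbabilityMeasure μ]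
    [IsProbabilityMeasure ν] : Measurable fun t => gaussianEnergy t μ ν := by
  unfold gaussianEnergy
  have h : StronglyMeasurable fun q : ℝ × (ℂ × ℂ) =>
      Real.exp (-q.1 * dist q.2.1 q.2.2 ^ 2) := Continuous.stronglyMeasurable (by fun_prop)
  exact h.integral_prod_right.measurable

lemma gaussianEnergy_comm (t : ℝ) (μ ν : Measure ℂ) [SFinite μ] [SFinite ν] :
    gaussianEnergy t μ ν = gaussianEnergy t ν μ := by
  unfold gaussianEnergy
  rw [← integral_prod_swap]
  simp [dist_comm]

/-- The Gaussian energy in terms of characteristic functions. -/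
lemma gaussianEnergy_eq_integral_charFun {b : ℝ} (hb : 0 < b) (μ ν : Measure ℂ)
    [IsProbabilityMeasure μ] [IsProbabilityMeasure ν] :
    ((Real.pi / b * gaussianEnergy (4 * b)⁻¹ μ ν : ℝ) : ℂ) =
      ∫ v : ℂ, (Real.exp (-b * ‖v‖ ^ 2) : ℂ) *
        (charFun μ v * (starRingEnd ℂ) (charFun ν v)) := by
  have hg : Integrable fun v : ℂ => (Real.exp (-b * ‖v‖ ^ 2) : ℂ) := by
    have := GaussianFourier.integrable_cexp_neg_mul_sq_norm_add (V := ℂ) (b := (b : ℂ)) (by simpa using hb) 0 0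
    simpa using this
  have h1 : ∀ w : ℂ, ∫ v : ℂ, (Real.exp (-b * ‖v‖ ^ 2) : ℂ) *
      Complex.exp (inner ℝ w v * Complex.I) =
        ((Real.pi / b * Real.exp (-(4 * b)⁻¹ * ‖w‖ ^ 2) : ℝ) : ℂ) := by
    intro w
    have := GaussianFourier.integral_cexp_neg_mul_sq_norm_add (V := ℂ) (b := (b : ℂ)) (by simpa using hb)
      Complex.I w
    -- The Gaussian prefactor is $\pi/b$ to the power $\dim/2$, and $\mathbb C$ has real dimension
    -- 2.
    simp only [Complex.finrank_real_complex, Nat.cast_ofNat, ne_eq, OfNat.ofNat_ne_zero,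
      not_false_eq_true, div_self, Complex.cpow_one, Complex.I_sq] at this
    push_cast
    convert! this using 2
    · ext v
      rw [← Complex.exp_add, mul_comm Complex.I]
    · congr 1
      field_simp
  have h2 : ∀ v : ℂ, charFun μ v * (starRingEnd ℂ) (charFun ν v) =
      ∫ p : ℂ × ℂ, Complex.exp (inner ℝ (p.1 - p.2) v * Complex.I) ∂(μ.prod ν) := by
    intro v
    rw [← charFun_neg, charFun_apply, charFun_apply, ← integral_prod_mul]
    congr 1
    ext p
    rw [← Complex.exp_add, inner_sub_left, inner_neg_right]
    push_cast
    ring_nf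
  simp_rw [h2, ← integral_const_mul]
  rw [integral_integral_swap]
  · simp_rw [h1]
    rw [integral_complex_ofReal, integral_const_mul, gaussianEnergy]
    simp_rw [dist_eq_norm]
  · have := hg.mul_prod (integrable_const (1 : ℂ) (μ := μ.prod ν))
    refine this.mono (Continuous.aestronglyMeasurable (by unfold Function.uncurry; fun_prop))
      (ae_of_all _ fun q => ?_)
    simp [Function.uncurry, Complex.norm_exp]

/-- The Gaussian kernel is strictly positive definite. -/
lemma two_mul_gaussianEnergy_lt {t : ℝ} (ht : 0 < t) {μ ν : Measure ℂ}
    [IsProbabilityMeasure μ] [IsProbabilityMeasure ν] (h : μ ≠ ν) :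
    2 * gaussianEnergy t μ ν < gaussianEnergy t μ μ + gaussianEnergy t ν ν := by
  obtain ⟨b, hb, rfl⟩ : ∃ b : ℝ, 0 < b ∧ (4 * b)⁻¹ = t :=
    ⟨(4 * t)⁻¹, by positivity, by field_simp⟩
  -- The defect of the inequality is $b/\pi$ times $\int e^{-b|v|^2}|\hat\mu-\hat\nu|^2$.
  -- Characteristic functions determine measures, so this continuous nonnegative integrand is
  -- positive somewhere.
  have hne : charFun μ ≠ charFun ν := fun h' => h (Measure.ext_of_charFun h')
  obtain ⟨v₀, hv₀⟩ := Function.ne_iff.1 hne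
  have hg : Integrable fun v : ℂ => Real.exp (-b * ‖v‖ ^ 2) := by
    have := (GaussianFourier.integrable_cexp_neg_mul_sq_norm_add (V := ℂ) (b := (b : ℂ))
      (by simpa using hb) 0 0).re
    refine this.congr (ae_of_all _ fun v => ?_)
    have : (-(b : ℂ) * (‖v‖ : ℂ) ^ 2 + 0 * (inner ℝ (0 : ℂ) v : ℝ)) =
      ((-b * ‖v‖ ^ 2 : ℝ) : ℂ) := by push_cast; ring
    simp only [this, ← Complex.ofReal_exp]
    rfl
  have hmul : ∀ (μ ν : Measure ℂ) [IsProbabilityMeasure μ] [IsProbabilityMeasure ν],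
      Integrable fun v : ℂ => (Real.exp (-b * ‖v‖ ^ 2) : ℂ) *
        (charFun μ v * (starRingEnd ℂ) (charFun ν v)) := by
    intro μ ν _ _
    refine hg.ofReal.mul_bdd (c := 1) (Measurable.aestronglyMeasurable (by fun_prop))
      (ae_of_all _ fun v => ?_)
    rw [norm_mul, RCLike.norm_conj]
    exact mul_le_one₀ (norm_charFun_le_one v) (norm_nonneg _) (norm_charFun_le_one v)
  have hc : Continuous fun v : ℂ => Real.exp (-b * ‖v‖ ^ 2) * ‖charFun μ v - charFun ν v‖ ^ 2 := by
    fun_prop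
  have hi : Integrable fun v : ℂ =>
      Real.exp (-b * ‖v‖ ^ 2) * ‖charFun μ v - charFun ν v‖ ^ 2 := by
    -- Two characteristic functions of probability measures differ by at most 2 in modulus.
    refine hg.mul_bdd (c := 4) (Continuous.aestronglyMeasurable (by fun_prop))
      (ae_of_all _ fun v => ?_)
    have hμ1 := norm_charFun_le_one (μ := μ) v
    have hν1 := norm_charFun_le_one (μ := ν) v
    have h1 := norm_sub_le (charFun μ v) (charFun ν v)
    rw [norm_pow, norm_norm]
    nlinarith [norm_nonneg (charFun μ v - charFun ν v)]
  have hpos : 0 < ∫ v : ℂ, Real.exp (-b * ‖v‖ ^ 2) * ‖charFun μ v - charFun ν v‖ ^ 2 := by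
    refine integral_pos_of_integrable_nonneg_nonzero hc hi (fun v => by positivity) (x := v₀) ?_
    have := norm_pos_iff.2 (sub_ne_zero.2 hv₀)
    positivity
  have key : ∫ v : ℂ, Real.exp (-b * ‖v‖ ^ 2) * ‖charFun μ v - charFun ν v‖ ^ 2 =
      Real.pi / b * (gaussianEnergy (4 * b)⁻¹ μ μ + gaussianEnergy (4 * b)⁻¹ ν ν
        - 2 * gaussianEnergy (4 * b)⁻¹ μ ν) := by
    have e : ∀ v : ℂ, ((Real.exp (-b * ‖v‖ ^ 2) * ‖charFun μ v - charFun ν v‖ ^ 2 : ℝ) : ℂ) =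
        (Real.exp (-b * ‖v‖ ^ 2) : ℂ) * (charFun μ v * (starRingEnd ℂ) (charFun μ v)) +
        (Real.exp (-b * ‖v‖ ^ 2) : ℂ) * (charFun ν v * (starRingEnd ℂ) (charFun ν v)) -
        ((Real.exp (-b * ‖v‖ ^ 2) : ℂ) * (charFun μ v * (starRingEnd ℂ) (charFun ν v)) +
        (Real.exp (-b * ‖v‖ ^ 2) : ℂ) * (charFun ν v * (starRingEnd ℂ) (charFun μ v))) := by
      intro v
      rw [Complex.ofReal_mul, Complex.ofReal_pow, ← Complex.mul_conj', map_sub]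
      ring
    have h1 := integral_complex_ofReal (μ := (volume : Measure ℂ))
      (f := fun v : ℂ => Real.exp (-b * ‖v‖ ^ 2) * ‖charFun μ v - charFun ν v‖ ^ 2)
    have hs : ∀ (μ ν μ' ν' : Measure ℂ) [IsProbabilityMeasure μ] [IsProbabilityMeasure ν]
        [IsProbabilityMeasure μ'] [IsProbabilityMeasure ν'], Integrable fun v : ℂ =>
          (Real.exp (-b * ‖v‖ ^ 2) : ℂ) * (charFun μ v * (starRingEnd ℂ) (charFun ν v)) +
          (Real.exp (-b * ‖v‖ ^ 2) : ℂ) * (charFun μ' v * (starRingEnd ℂ) (charFun ν' v)) :=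
      fun μ ν μ' ν' => (hmul μ ν).add (hmul μ' ν')
    rw [integral_congr_ae (ae_of_all _ e), integral_sub (hs μ μ ν ν) (hs μ ν ν μ),
      integral_add (hmul μ μ) (hmul ν ν), integral_add (hmul μ ν) (hmul ν μ),
      ← gaussianEnergy_eq_integral_charFun hb, ← gaussianEnergy_eq_integral_charFun hb,
      ← gaussianEnergy_eq_integral_charFun hb, ← gaussianEnergy_eq_integral_charFun hb,
      gaussianEnergy_comm _ ν μ] at h1
    have h2 := Complex.ofReal_injective (by rw [← h1]; push_cast; rfl :
      ((∫ v : ℂ, Real.exp (-b * ‖v‖ ^ 2) * ‖charFun μ v - charFun ν v‖ ^ 2 : ℝ) : ℂ) =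
      ((Real.pi / b * gaussianEnergy (4 * b)⁻¹ μ μ + Real.pi / b * gaussianEnergy (4 * b)⁻¹ ν ν
        - (Real.pi / b * gaussianEnergy (4 * b)⁻¹ μ ν
          + Real.pi / b * gaussianEnergy (4 * b)⁻¹ μ ν) : ℝ) : ℂ))
    rw [h2]
    ring
  rw [key] at hpos
  have := pos_of_mul_pos_right hpos (by positivity)
  linarith

/-! ### Strict convexity of the energy and uniqueness of the minimizer -/

/-- The energy for `logKernel R` is strictly convex. -/
lemma two_mul_mutualEnergy_lt {F : Set ℂ} {R : ℝ} (hR : 0 < R)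
    (hF : ∀ x ∈ F, ∀ y ∈ F, dist x y ≤ R) {μ ν : Measure ℂ} [IsProbabilityMeasure μ]
    [IsProbabilityMeasure ν] (hμ : μ Fᶜ = 0) (hν : ν Fᶜ = 0) (h : μ ≠ ν)
    (hfin : mutualEnergy R μ μ + mutualEnergy R ν ν ≠ ⊤) :
    2 * mutualEnergy R μ ν < mutualEnergy R μ μ + mutualEnergy R ν ν := by
  have hm : ∀ (μ ν : Measure ℂ) [IsProbabilityMeasure μ] [IsProbabilityMeasure ν],
      Measurable fun t : ℝ =>
        ENNReal.ofReal ((gaussianEnergy t μ ν - Real.exp (-t * R ^ 2)) / t) := by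
    intro μ ν _ _
    have := measurable_gaussianEnergy μ ν
    fun_prop
  have hlt : ∀ᵐ t ∂(volume.restrict (Set.Ioi (0 : ℝ))),
      2 * ENNReal.ofReal ((gaussianEnergy t μ ν - Real.exp (-t * R ^ 2)) / t) <
        ENNReal.ofReal ((gaussianEnergy t μ μ - Real.exp (-t * R ^ 2)) / t) +
        ENNReal.ofReal ((gaussianEnergy t ν ν - Real.exp (-t * R ^ 2)) / t) := by
    filter_upwards [ae_restrict_mem measurableSet_Ioi] with t ht
    have ht' : 0 < t := ht
    have hp := two_mul_gaussianEnergy_lt ht' h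
    have h1 := (lintegral_gaussian_sub hF hμ hμ ht').1
    have h2 := (lintegral_gaussian_sub hF hν hν ht').1
    have h3 := (lintegral_gaussian_sub hF hμ hν ht').1
    rw [show (2 : ℝ≥0∞) = ENNReal.ofReal 2 by simp, ← ENNReal.ofReal_mul zero_le_two,
      ← ENNReal.ofReal_add (div_nonneg h1 ht'.le) (div_nonneg h2 ht'.le), ← add_div,
      ← mul_div_assoc]
    -- The constants cancel, two on each side, which leaves the strict Gaussian inequality.
    have h4 : 2 * (gaussianEnergy t μ ν - Real.exp (-t * R ^ 2)) <
      gaussianEnergy t μ μ - Real.exp (-t * R ^ 2) +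
        (gaussianEnergy t ν ν - Real.exp (-t * R ^ 2)) := by linarith
    refine (ENNReal.ofReal_lt_ofReal_iff (div_pos (by linarith) ht')).2 ?_
    exact div_lt_div_of_pos_right h4 ht'
  have e1 : ∫⁻ t in Set.Ioi (0 : ℝ),
      (ENNReal.ofReal ((gaussianEnergy t μ μ - Real.exp (-t * R ^ 2)) / t) +
        ENNReal.ofReal ((gaussianEnergy t ν ν - Real.exp (-t * R ^ 2)) / t)) =
      2 * (mutualEnergy R μ μ + mutualEnergy R ν ν) := by
    rw [lintegral_add_left (hm μ μ), mul_add, two_mul_mutualEnergy hR hF hμ hμ,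
      two_mul_mutualEnergy hR hF hν hν]
  have e2 : ∫⁻ t in Set.Ioi (0 : ℝ),
      2 * ENNReal.ofReal ((gaussianEnergy t μ ν - Real.exp (-t * R ^ 2)) / t) =
      2 * (2 * mutualEnergy R μ ν) := by
    rw [lintegral_const_mul _ (hm μ ν), two_mul_mutualEnergy hR hF hμ hν]
  -- A strict pointwise inequality survives integration only if the smaller integral is finite; this
  -- is where `hfin` enters.
  have hle := lintegral_mono_ae (hlt.mono fun t h => h.le)
  have hs := lintegral_strict_mono (by simp) ((hm μ μ).add (hm ν ν)).aemeasurable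
    (ne_top_of_le_ne_top (by rw [e1]; exact ENNReal.mul_ne_top (by simp) hfin) hle) hlt
  simp only [Pi.add_apply] at hs
  rw [e1, e2] at hs
  exact lt_of_mul_lt_mul_left' hs

lemma four_mul_mutualEnergy_midpoint (R : ℝ) (μ ν : Measure ℂ) [IsProbabilityMeasure μ]
    [IsProbabilityMeasure ν] :
    4 * mutualEnergy R ((2 : ℝ≥0∞)⁻¹ • (μ + ν)) ((2 : ℝ≥0∞)⁻¹ • (μ + ν)) =
      mutualEnergy R μ μ + mutualEnergy R ν ν + 2 * mutualEnergy R μ ν := by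
  have hm : ∀ ν : Measure ℂ, SFinite ν → Measurable fun x => ∫⁻ y, logKernel R x y ∂ν :=
    fun ν _ => (measurable_logKernel R).lintegral_prod_right'
  have h4 : (4 : ℝ≥0∞) * (2⁻¹ * 2⁻¹) = 1 := by
    rw [← ENNReal.mul_inv (by simp) (by simp), show (2 : ℝ≥0∞) * 2 = 4 by norm_num]
    exact ENNReal.mul_inv_cancel (by simp) (by simp)
  have e : mutualEnergy R ((2 : ℝ≥0∞)⁻¹ • (μ + ν)) ((2 : ℝ≥0∞)⁻¹ • (μ + ν)) =
      2⁻¹ * 2⁻¹ * (mutualEnergy R μ μ + mutualEnergy R μ ν +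
        (mutualEnergy R ν μ + mutualEnergy R ν ν)) := by
    simp only [mutualEnergy, lintegral_smul_measure, lintegral_add_measure, smul_eq_mul]
    have hs : Measurable fun x => ∫⁻ y, logKernel R x y ∂μ + ∫⁻ y, logKernel R x y ∂ν :=
      (hm μ inferInstance).add (hm ν inferInstance)
    rw [lintegral_const_mul _ hs, lintegral_const_mul _ hs, lintegral_add_left (hm μ inferInstance), lintegral_add_left (hm μ inferInstance)]
    ring
  rw [e, ← mul_assoc, h4, one_mul, mutualEnergy_comm R ν μ]
  ring

/-- An equilibrium measure of finite energy is unique. -/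
lemma IsEquilibriumMeasure.eq_of_mutualEnergy_ne_top {F : Set ℂ} {R : ℝ} (hR : 1 ≤ R)
    (hF : ∀ x ∈ F, ∀ y ∈ F, dist x y ≤ R) {μ ν : Measure ℂ} (hμ : IsEquilibriumMeasure F μ)
    (hν : IsEquilibriumMeasure F ν) (hfin : mutualEnergy R μ μ ≠ ⊤) : μ = ν := by
  have := hμ.isProbabilityMeasure
  have := hν.isProbabilityMeasure
  by_contra hne
  have hVle : mutualEnergy R ν ν ≤ mutualEnergy R μ μ :=
    (energy_le_energy_iff hR hF hν.compl_null hμ.compl_null).1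
      (hν.energy_le μ inferInstance hμ.compl_null)
  have hVge : mutualEnergy R μ μ ≤ mutualEnergy R ν ν :=
    (energy_le_energy_iff hR hF hμ.compl_null hν.compl_null).1
      (hμ.energy_le ν inferInstance hν.compl_null)
  have hV := le_antisymm hVle hVge
  have hm1 : IsProbabilityMeasure ((2 : ℝ≥0∞)⁻¹ • (μ + ν)) := by
    constructor
    simp only [Measure.smul_apply, Measure.add_apply, measure_univ, smul_eq_mul]
    rw [one_add_one_eq_two]
    exact ENNReal.inv_mul_cancel (by simp) (by simp)
  have hm0 : ((2 : ℝ≥0∞)⁻¹ • (μ + ν)) Fᶜ = 0 := by simp [hμ.compl_null, hν.compl_null]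
  -- If $\mu\ne\nu$ both have energy $V$, the midpoint has energy $\frac14(2V+2I(\mu,\nu))<V$,
  -- against minimality.
  have hmid : mutualEnergy R μ μ ≤ _ :=
    (energy_le_energy_iff hR hF hμ.compl_null hm0).1 (hμ.energy_le _ hm1 hm0)
  have h4 := mul_le_mul_right hmid 4
  rw [four_mul_mutualEnergy_midpoint, hV] at h4
  have hlt := two_mul_mutualEnergy_lt (by linarith) hF hμ.compl_null hν.compl_null hne
    (by rw [hV]; exact ENNReal.add_ne_top.2 ⟨hfin, hfin⟩)
  rw [hV] at hlt
  have hsum : mutualEnergy R μ μ + mutualEnergy R μ μ ≠ ⊤ := ENNReal.add_ne_top.2 ⟨hfin, hfin⟩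
  have h5 := ENNReal.add_lt_add_left hsum hlt
  refine absurd (h4.trans_lt h5) (not_lt.2 (le_of_eq ?_))
  ring


/-! ### The transfinite diameter bounds the energy from below -/

lemma toReal_prod_edist_rpow {ι : Type*} {s : Finset ι} {f g : ι → ℂ}
    (h : ∀ p ∈ s, f p ≠ g p) (k : ℝ) :
    0 < (∏ p ∈ s, edist (f p) (g p) ^ k).toReal ∧
      Real.log (∏ p ∈ s, edist (f p) (g p) ^ k).toReal =
        k * ∑ p ∈ s, Real.log (dist (f p) (g p)) := by
  have e : (∏ p ∈ s, edist (f p) (g p) ^ k).toReal = ∏ p ∈ s, dist (f p) (g p) ^ k := by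
    rw [ENNReal.toReal_prod]
    refine Finset.prod_congr rfl fun p _ => ?_
    rw [← ENNReal.toReal_rpow, edist_dist, ENNReal.toReal_ofReal dist_nonneg]
  have hpos : ∀ p ∈ s, 0 < dist (f p) (g p) ^ k := fun p hp =>
    Real.rpow_pos_of_pos (dist_pos.2 (h p hp)) _
  rw [e]
  refine ⟨Finset.prod_pos hpos, ?_⟩
  rw [Real.log_prod (fun p hp => (hpos p hp).ne'), Finset.mul_sum]
  exact Finset.sum_congr rfl fun p hp => Real.log_rpow (dist_pos.2 (h p hp)) k

lemma nthDiameter_ne_top {F : Set ℂ} {R : ℝ} (hF : ∀ x ∈ F, ∀ y ∈ F, dist x y ≤ R) {n : ℕ}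
    (hn : 2 ≤ n) : nthDiameter n F ≠ ⊤ := by
  have hn' : (2 : ℝ) ≤ n := by exact_mod_cast hn
  have hm : 0 ≤ ((n : ℝ) * ((n : ℝ) - 1))⁻¹ := inv_nonneg.2 (by nlinarith)
  refine ne_top_of_le_ne_top
    (b := ∏ p ∈ (Finset.univ : Finset (Fin n)).offDiag,
      ENNReal.ofReal R ^ (((n : ℝ) * ((n : ℝ) - 1))⁻¹)) ?_ ?_
  · exact ENNReal.prod_ne_top fun p _ => ENNReal.rpow_ne_top_of_nonneg hm ENNReal.ofReal_ne_top
  · refine iSup_le fun x => Finset.prod_le_prod' fun p _ => ?_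
    refine ENNReal.rpow_le_rpow ?_ hm
    rw [edist_dist]
    exact ENNReal.ofReal_le_ofReal (hF _ (x p.1).2 _ (x p.2).2)

lemma transfiniteDiameter_le_nthDiameter {n : ℕ} (hn : 2 ≤ n) (F : Set ℂ) :
    transfiniteDiameter F ≤ nthDiameter n F := by
  -- The diameters are known to decrease only from index 2 on, hence the shift.
  have h : Antitone fun n : ℕ => nthDiameter (n + 2) F :=
    antitone_nat_of_succ_le fun n => nthDiameter_succ_le (by omega) F
  have := h.le_of_tendsto ((tendsto_add_atTop_iff_nat 2).2 (tendsto_nthDiameter F)) (n - 2)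
  simpa [Nat.sub_add_cancel hn] using this

lemma transfiniteDiameter_ne_top {F : Set ℂ} {R : ℝ} (hF : ∀ x ∈ F, ∀ y ∈ F, dist x y ≤ R) :
    transfiniteDiameter F ≠ ⊤ :=
  ne_top_of_le_ne_top (nthDiameter_ne_top hF le_rfl) (transfiniteDiameter_le_nthDiameter le_rfl F)

lemma card_offDiag_cast {α : Type*} [DecidableEq α] (s : Finset α) :
    (s.offDiag.card : ℝ) = (s.card : ℝ) * ((s.card : ℝ) - 1) := by
  rw [Finset.offDiag_card, Nat.cast_sub (Nat.le_mul_self _)]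
  push_cast
  ring

/-- For distinct points this is the logarithm of the definition of the $n$th diameter as a supremum;
if two points coincide, the sum is infinite. -/
lemma card_mul_le_sum_logKernel {F : Set ℂ} {R : ℝ} (hR : 1 ≤ R)
    (hF : ∀ x ∈ F, ∀ y ∈ F, dist x y ≤ R) {n : ℕ} (hn : 2 ≤ n) (x : Fin n → ℂ)
    (hx : ∀ i, x i ∈ F) :
    ((Finset.univ : Finset (Fin n)).offDiag.card : ℝ≥0∞) *
        ENNReal.ofReal (Real.log R - Real.log (nthDiameter n F).toReal) ≤
      ∑ p ∈ (Finset.univ : Finset (Fin n)).offDiag, logKernel R (x p.1) (x p.2) := by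
  have hR0 : 0 < R := by linarith
  set s := (Finset.univ : Finset (Fin n)).offDiag with hs
  by_cases h : ∀ p ∈ s, x p.1 ≠ x p.2
  · have hn' : (2 : ℝ) ≤ n := by exact_mod_cast hn
    have hm : 0 < (n : ℝ) * ((n : ℝ) - 1) := by nlinarith
    have hcard : (s.card : ℝ) = (n : ℝ) * ((n : ℝ) - 1) := by
      rw [hs, card_offDiag_cast]
      simp
    obtain ⟨hpos, hlog⟩ := toReal_prod_edist_rpow h (((n : ℝ) * ((n : ℝ) - 1))⁻¹)
    have hle : tupleMean x ≤ nthDiameter n F :=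
      le_iSup (fun y : Fin n → F => tupleMean (fun i => (y i : ℂ))) (fun i => ⟨x i, hx i⟩)
    have hlogle := Real.log_le_log hpos (ENNReal.toReal_mono (nthDiameter_ne_top hF hn) hle)
    rw [hlog, inv_mul_le_iff₀ hm] at hlogle
    rw [Finset.sum_congr rfl fun p hp => logKernel_of_ne hR0 (h p hp),
      ← ENNReal.ofReal_sum_of_nonneg, ← ENNReal.ofReal_natCast,
      ← ENNReal.ofReal_mul (Nat.cast_nonneg _)]
    · refine ENNReal.ofReal_le_ofReal ?_
      rw [Finset.sum_sub_distrib, Finset.sum_const, nsmul_eq_mul, hcard, mul_sub]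
      linarith
    · intro p hp
      exact sub_nonneg.2 (Real.log_le_log (dist_pos.2 (h p hp)) (hF _ (hx _) _ (hx _)))
  · push Not at h
    obtain ⟨p, hp, hpe⟩ := h
    have : ∑ p ∈ s, logKernel R (x p.1) (x p.2) = ⊤ := by
      refine ENNReal.sum_eq_top.2 ⟨p, hp, ?_⟩
      rw [hpe, logKernel_self]
    rw [this]
    exact le_top

/-- Distinct coordinates are independent with law `ν`, so in the average over random $n$-tuples
every pair contributes the full energy of `ν`. -/
lemma lintegral_pi_pair {n : ℕ} (ν : Measure ℂ) [IsProbabilityMeasure ν] {i j : Fin n}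
    (hij : i ≠ j) {f : ℂ × ℂ → ℝ≥0∞} (hf : Measurable f) :
    ∫⁻ x, f (x i, x j) ∂(Measure.pi fun _ : Fin n => ν) = ∫⁻ p, f p ∂(ν.prod ν) := by
  have hind : ProbabilityTheory.iIndepFun (fun (i : Fin n) (x : Fin n → ℂ) => x i)
      (Measure.pi fun _ : Fin n => ν) :=
    ProbabilityTheory.iIndepFun_pi (X := fun _ => id) fun _ => aemeasurable_id
  have h := (ProbabilityTheory.indepFun_iff_map_prod_eq_prod_map_map
    (measurable_pi_apply i).aemeasurable (measurable_pi_apply j).aemeasurable).1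
    (hind.indepFun hij)
  have e : ∀ i : Fin n, (Measure.pi fun _ : Fin n => ν).map (fun x => x i) = ν := fun i =>
    (measurePreserving_eval (fun _ : Fin n => ν) i).map_eq
  rw [e, e] at h
  rw [← h, lintegral_map hf (by fun_prop)]

/-- Every probability measure carried by `F` has energy at least `-log c(F)`. -/
lemma ofReal_log_sub_log_le_mutualEnergy {F : Set ℂ} {R : ℝ} (hR : 1 ≤ R)
    (hF : ∀ x ∈ F, ∀ y ∈ F, dist x y ≤ R) (hc : 0 < transfiniteDiameter F) {ν : Measure ℂ}
    [IsProbabilityMeasure ν] (hν : ν Fᶜ = 0) :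
    ENNReal.ofReal (Real.log R - Real.log (transfiniteDiameter F).toReal) ≤
      mutualEnergy R ν ν := by
  have hctop := transfiniteDiameter_ne_top hF
  have hlim : Tendsto (fun n : ℕ =>
      ENNReal.ofReal (Real.log R - Real.log (nthDiameter n F).toReal)) atTop
      (𝓝 (ENNReal.ofReal (Real.log R - Real.log (transfiniteDiameter F).toReal))) := by
    refine ENNReal.tendsto_ofReal (tendsto_const_nhds.sub (Tendsto.log ?_ ?_))
    · exact (ENNReal.tendsto_toReal hctop).comp (tendsto_nthDiameter F)
    -- Positivity of $c(F)$ makes `Real.log` continuous there.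
    · exact (ENNReal.toReal_pos hc.ne' hctop).ne'
  refine le_of_tendsto hlim ?_
  filter_upwards [eventually_ge_atTop 2] with n hn
  have hae : ∀ᵐ x ∂(Measure.pi fun _ : Fin n => ν), ∀ i, x i ∈ F := by
    have h1 : ∀ᵐ x ∂ν, x ∈ F := hν
    exact ae_all_iff.2 fun i =>
      (measurePreserving_eval (fun _ : Fin n => ν) i).quasiMeasurePreserving.ae h1
  have h := lintegral_mono_ae (hae.mono fun x hx => card_mul_le_sum_logKernel hR hF hn x hx)
  rw [lintegral_const, measure_univ, mul_one, lintegral_finsetSum] at h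
  · have e : ∀ p ∈ (Finset.univ : Finset (Fin n)).offDiag,
        ∫⁻ x, logKernel R (x p.1) (x p.2) ∂(Measure.pi fun _ : Fin n => ν) =
          mutualEnergy R ν ν := by
      intro p hp
      rw [mutualEnergy_eq_lintegral_prod]
      exact lintegral_pi_pair ν (Finset.mem_offDiag.1 hp).2.2 (measurable_logKernel R)
    rw [Finset.sum_congr rfl e, Finset.sum_const, nsmul_eq_mul] at h
    refine (ENNReal.mul_le_mul_iff_right ?_ (ENNReal.natCast_ne_top _)).1 h
    rw [Finset.offDiag_card, Finset.card_univ, Fintype.card_fin]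
    have : n < n * n := by nlinarith
    exact_mod_cast (by omega : n * n - n ≠ 0)
  · intro p _
    have hp : Measurable fun x : Fin n → ℂ => (x p.1, x p.2) := by fun_prop
    exact (measurable_logKernel R).comp hp


/-! ### Truncated kernel and its averages over finite sets -/

lemma IsLogDistance.nonneg {F : Set ℂ} {lam : ℂ → ℝ} (h : IsLogDistance F lam) (z : ℂ) :
    0 ≤ lam z := by
  by_cases hz : z ∈ F
  · exact (h.eq_zero z hz).ge
  · exact (h.pos z hz).le

lemma isProbabilityMeasure_uniformMeasure {S : Finset ℂ} (hS : S.card ≠ 0) :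
    IsProbabilityMeasure (uniformMeasure S) := by
  constructor
  simp only [uniformMeasure, Measure.smul_apply, Measure.finsetSum_apply, measure_univ,
    Finset.sum_const, smul_eq_mul, nsmul_eq_mul, mul_one]
  exact ENNReal.inv_mul_cancel (by exact_mod_cast hS) (ENNReal.natCast_ne_top _)

lemma integrable_uniformMeasure {S : Finset ℂ} (hS : S.card ≠ 0) (f : ℂ → ℝ) :
    Integrable f (uniformMeasure S) := by
  refine Integrable.smul_measure ?_ (by simpa using hS)
  exact integrable_finsetSum_measure.2 fun z _ => integrable_dirac (by finiteness)

lemma integral_uniformMeasure (S : Finset ℂ) (f : ℂ → ℝ) :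
    ∫ z, f z ∂(uniformMeasure S) = (S.card : ℝ)⁻¹ * ∑ z ∈ S, f z := by
  rw [uniformMeasure, integral_smul_measure,
    integral_finsetSum_measure fun z _ => integrable_dirac (by finiteness)]
  simp

lemma integral_uniformMeasure_prod {S : Finset ℂ} (hS : S.card ≠ 0) {f : ℂ × ℂ → ℝ}
    (hf : Integrable f ((uniformMeasure S).prod (uniformMeasure S))) :
    ∫ p, f p ∂((uniformMeasure S).prod (uniformMeasure S)) =
      (S.card : ℝ)⁻¹ * ((S.card : ℝ)⁻¹ * ∑ p ∈ S ×ˢ S, f p) := by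
  have := isProbabilityMeasure_uniformMeasure hS
  rw [integral_prod _ hf]
  simp_rw [integral_uniformMeasure]
  rw [← Finset.mul_sum, Finset.sum_product]

/-- A bounded continuous minorant of the kernel `lam x + lam y - log |x - y|`. -/
def truncKernel (lam : ℂ → ℝ) (δ : ℝ) (p : ℂ × ℂ) : ℝ :=
  min (-Real.log δ) (lam p.1 + lam p.2 - Real.log (max (dist p.1 p.2) δ))

lemma continuous_truncKernel {lam : ℂ → ℝ} (h : Continuous lam) {δ : ℝ} (hδ : 0 < δ) :
    Continuous (truncKernel lam δ) := by
  unfold truncKernel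
  refine continuous_const.min (Continuous.sub (by fun_prop) (Continuous.log (by fun_prop) ?_))
  exact fun p => (lt_max_of_lt_right hδ).ne'

lemma log_max_dist_le {δ : ℝ} (hδ : 0 < δ) (hδ1 : δ ≤ 1) (x y : ℂ) :
    Real.log (max (dist x y) δ) ≤ Real.log 2 + Real.posLog ‖x‖ + Real.posLog ‖y‖ := by
  have h1 : Real.log (max (dist x y) δ) ≤ Real.posLog (‖x‖ + ‖y‖) := by
    rw [Real.posLog_eq_log_max_one (by positivity)]
    refine Real.log_le_log (lt_max_of_lt_right hδ) (max_le ?_ (le_max_of_le_left hδ1))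
    rw [dist_eq_norm]
    exact le_max_of_le_right (norm_sub_le x y)
  exact h1.trans Real.posLog_add

/-- The lower bound uses that $\lambda(x)+\lambda(y)$ compensates the growth of $\log|x-y|$ at
infinity up to $\log 2+2C$; the upper bound is the cutoff $-\log\delta$. -/
lemma exists_abs_truncKernel_le {F : Set ℂ} {lam : ℂ → ℝ} (h : IsLogDistance F lam) {δ : ℝ}
    (hδ : 0 < δ) (hδ1 : δ ≤ 1) : ∃ B, ∀ p, |truncKernel lam δ p| ≤ B := by
  obtain ⟨C, hC⟩ := h.bounded
  refine ⟨max (-Real.log δ) (Real.log 2 + 2 * C), fun p => abs_le.2 ⟨?_, ?_⟩⟩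
  · have h1 := log_max_dist_le hδ hδ1 p.1 p.2
    have h2 := (abs_le.1 (hC p.1)).1
    have h3 := (abs_le.1 (hC p.2)).1
    have h4 : 0 ≤ -Real.log δ := neg_nonneg.2 (Real.log_nonpos hδ.le hδ1)
    refine le_min ?_ ?_
    · have := le_max_left (-Real.log δ) (Real.log 2 + 2 * C)
      linarith
    · have := le_max_right (-Real.log δ) (Real.log 2 + 2 * C)
      linarith
  · exact (min_le_left _ _).trans (le_max_left _ _)

/-- `truncKernel` as a bounded continuous function. -/
def truncKernelBCF {F : Set ℂ} {lam : ℂ → ℝ} (h : IsLogDistance F lam) {δ : ℝ}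
    (hδ : 0 < δ) (hδ1 : δ ≤ 1) : (ℂ × ℂ) →ᵇ ℝ :=
  BoundedContinuousFunction.ofNormedAddCommGroup (truncKernel lam δ)
    (continuous_truncKernel h.continuous hδ) (exists_abs_truncKernel_le h hδ hδ1).choose
    (exists_abs_truncKernel_le h hδ hδ1).choose_spec

lemma sum_offDiag_log_dist {S : Finset ℂ} (hS : 2 ≤ S.card) :
    0 < (finsetMean S).toReal ∧ ∑ p ∈ S.offDiag, Real.log (dist p.1 p.2) =
      (S.card : ℝ) * ((S.card : ℝ) - 1) * Real.log (finsetMean S).toReal := by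
  have hS' : (2 : ℝ) ≤ S.card := by exact_mod_cast hS
  have hm : 0 < (S.card : ℝ) * ((S.card : ℝ) - 1) := by nlinarith
  obtain ⟨hpos, hlog⟩ := toReal_prod_edist_rpow (s := S.offDiag) (f := Prod.fst) (g := Prod.snd)
    (fun p hp => (Finset.mem_offDiag.1 hp).2.2) (((S.card : ℝ) * ((S.card : ℝ) - 1))⁻¹)
  refine ⟨hpos, ?_⟩
  rw [finsetMean, hlog, mul_inv_cancel_left₀ hm.ne']

/-- The cutoff caps the $N$ diagonal terms, so they contribute $O(1/N)$ for fixed $\delta$; off the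
diagonal the kernel is at most $\lambda(x)+\lambda(y)-\log|x-y|$. -/
lemma sum_truncKernel_le {F : Set ℂ} {lam : ℂ → ℝ} (h : IsLogDistance F lam) {δ : ℝ}
    {S : Finset ℂ} (hS : 2 ≤ S.card) :
    (S.card : ℝ)⁻¹ * ((S.card : ℝ)⁻¹ * ∑ p ∈ S ×ˢ S, truncKernel lam δ p) ≤
      (S.card : ℝ)⁻¹ * -Real.log δ + 2 * ((S.card : ℝ)⁻¹ * ∑ z ∈ S, lam z) -
        (1 - (S.card : ℝ)⁻¹) * Real.log (finsetMean S).toReal := by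
  have hN : (0 : ℝ) < S.card := by exact_mod_cast (by omega : 0 < S.card)
  have hsplit : ∑ p ∈ S ×ˢ S, truncKernel lam δ p =
      ∑ p ∈ S.diag, truncKernel lam δ p + ∑ p ∈ S.offDiag, truncKernel lam δ p := by
    rw [← Finset.sum_union (Finset.disjoint_diag_offDiag S), Finset.diag_union_offDiag]
  have hd : ∑ p ∈ S.diag, truncKernel lam δ p ≤ S.card * -Real.log δ := by
    have := Finset.sum_le_card_nsmul S.diag (truncKernel lam δ) (-Real.log δ)
      fun p _ => min_le_left _ _
    rwa [Finset.diag_card, nsmul_eq_mul] at this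
  have ho : ∑ p ∈ S.offDiag, truncKernel lam δ p ≤
      ∑ p ∈ S.offDiag, (lam p.1 + lam p.2) - ∑ p ∈ S.offDiag, Real.log (dist p.1 p.2) := by
    rw [← Finset.sum_sub_distrib]
    refine Finset.sum_le_sum fun p hp => (min_le_right _ _).trans ?_
    have := Real.log_le_log (dist_pos.2 (Finset.mem_offDiag.1 hp).2.2)
      (le_max_left (dist p.1 p.2) δ)
    linarith
  have hl : ∑ p ∈ S.offDiag, (lam p.1 + lam p.2) ≤ 2 * (S.card * ∑ z ∈ S, lam z) := by
    -- Since $\lambda\ge0$, the diagonal may be added back, and the double sum factors.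
    refine (Finset.sum_le_sum_of_subset_of_nonneg (t := S ×ˢ S) ?_ ?_).trans_eq ?_
    · rw [← Finset.diag_union_offDiag]
      exact Finset.subset_union_right
    · exact fun p _ _ => add_nonneg (h.nonneg _) (h.nonneg _)
    · rw [Finset.sum_product]
      simp only [Finset.sum_add_distrib, Finset.sum_const, nsmul_eq_mul, ← Finset.mul_sum]
      ring
  rw [(sum_offDiag_log_dist hS).2] at ho
  have key : ∑ p ∈ S ×ˢ S, truncKernel lam δ p ≤ S.card * -Real.log δ +
      (2 * (S.card * ∑ z ∈ S, lam z) -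
        S.card * (S.card - 1) * Real.log (finsetMean S).toReal) := by linarith
  have hi : (0 : ℝ) ≤ (S.card : ℝ)⁻¹ := by positivity
  refine (mul_le_mul_of_nonneg_left (mul_le_mul_of_nonneg_left key hi) hi).trans_eq ?_
  field_simp
  ring

/-! ### Weak limits: support and energy -/

section Limit

variable {F : Set ℂ} {lam : ℂ → ℝ} {S : ℕ → Finset ℂ} {U : Filter ℕ} [U.NeBot]
  {u : ℕ → ProbabilityMeasure ℂ} {μ : ProbabilityMeasure ℂ}

/-- A limit of the uniform measures of a taut sequence is carried by `F`. -/
lemma compl_null_of_tendsto (hlam : IsLogDistance F lam) (hS : IsTaut lam S) (hU : U ≤ atTop)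
    (hu : ∀ᶠ n in atTop, (u n : Measure ℂ) = uniformMeasure (S n))
    (hμ : Tendsto u U (𝓝 μ)) : (μ : Measure ℂ) Fᶜ = 0 := by
  have hbd : ∀ z, |min (lam z) 1| ≤ 1 := fun z =>
    abs_le.2 ⟨le_min (by linarith [hlam.nonneg z]) (by norm_num), min_le_right _ _⟩
  -- A bounded test function, positive exactly off $F$, whose averages are dominated by those of
  -- $\lambda$.
  let g : ℂ →ᵇ ℝ := BoundedContinuousFunction.ofNormedAddCommGroup (fun z => min (lam z) 1)
    (hlam.continuous.min continuous_const) 1 hbd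
  have h1 := ProbabilityMeasure.tendsto_iff_forall_integral_tendsto.1 hμ g
  have h2 : ∫ z, g z ∂(μ : Measure ℂ) ≤ 0 := by
    refine le_of_tendsto_of_tendsto h1 (hS.mono_left hU) ?_
    filter_upwards [hU hu] with n hn
    rw [hn, integral_uniformMeasure]
    exact mul_le_mul_of_nonneg_left (Finset.sum_le_sum fun z _ => min_le_left _ _) (by positivity)
  have hg : ∀ z, 0 ≤ g z := fun z => le_min (hlam.nonneg z) zero_le_one
  have h3 := (integral_eq_zero_iff_of_nonneg hg (g.integrable _)).1
    (le_antisymm h2 (integral_nonneg hg))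
  have h4 : ∀ᵐ z ∂(μ : Measure ℂ), z ∈ F := by
    filter_upwards [h3] with z hz
    by_contra hzF
    have : 0 < g z := lt_min (hlam.pos z hzF) one_pos
    exact this.ne' hz
  exact h4

lemma integral_truncKernel_le (hc : 0 < transfiniteDiameter F)
    (hctop : transfiniteDiameter F ≠ ⊤)
    (hlam : IsLogDistance F lam) (hS : IsPseudoEquidistributed F lam S) (hU : U ≤ atTop)
    (hu : ∀ᶠ n in atTop, (u n : Measure ℂ) = uniformMeasure (S n))
    (hμ : Tendsto u U (𝓝 μ)) {δ : ℝ} (hδ : 0 < δ) (hδ1 : δ ≤ 1) :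
    ∫ p, truncKernel lam δ p ∂((μ : Measure ℂ).prod (μ : Measure ℂ)) ≤
      -Real.log (transfiniteDiameter F).toReal := by
  let g := truncKernelBCF hlam hδ hδ1
  have hprod : Tendsto (fun n => (u n).prod (u n)) U (𝓝 (μ.prod μ)) :=
    (ProbabilityMeasure.continuous_prod.tendsto (μ, μ)).comp (hμ.prodMk_nhds hμ)
  have h1 := ProbabilityMeasure.tendsto_iff_forall_integral_tendsto.1 hprod g
  have hinv : Tendsto (fun n => ((S n).card : ℝ)⁻¹) atTop (𝓝 0) :=
    tendsto_inv_atTop_zero.comp (tendsto_natCast_atTop_atTop.comp hS.fekete.card)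
  have hlog : Tendsto (fun n => Real.log (finsetMean (S n)).toReal) atTop
      (𝓝 (Real.log (transfiniteDiameter F).toReal)) :=
    Tendsto.log ((ENNReal.tendsto_toReal hctop).comp hS.fekete.mean)
      (ENNReal.toReal_pos hc.ne' hctop).ne'
  have h2 : Tendsto (fun n => ((S n).card : ℝ)⁻¹ * -Real.log δ +
      2 * (((S n).card : ℝ)⁻¹ * ∑ z ∈ S n, lam z) -
        (1 - ((S n).card : ℝ)⁻¹) * Real.log (finsetMean (S n)).toReal) atTop
      (𝓝 (-Real.log (transfiniteDiameter F).toReal)) := by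
    have := ((hinv.mul_const (-Real.log δ)).add (hS.taut.const_mul 2)).sub
      ((hinv.const_sub 1).mul hlog)
    simpa using this
  refine le_of_tendsto_of_tendsto h1 (h2.mono_left hU) ?_
  filter_upwards [hU hu, hU (hS.fekete.card.eventually_ge_atTop 2)] with n hn hn2
  have hi := g.integrable ((u n : Measure ℂ).prod (u n : Measure ℂ))
  rw [hn] at hi
  rw [ProbabilityMeasure.toMeasure_prod, hn, integral_uniformMeasure_prod (by omega) hi]
  exact sum_truncKernel_le hlam hn2

/-- A limit of the uniform measures of a pseudo-equidistributed sequence has energy at most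
`-log c(F)`. -/
lemma mutualEnergy_le_of_tendsto (hc : 0 < transfiniteDiameter F) {R : ℝ}
    (hR : 1 ≤ R) (hFR : ∀ x ∈ F, ∀ y ∈ F, dist x y ≤ R)
    (hlam : IsLogDistance F lam) (hS : IsPseudoEquidistributed F lam S) (hU : U ≤ atTop)
    (hu : ∀ᶠ n in atTop, (u n : Measure ℂ) = uniformMeasure (S n))
    (hμ : Tendsto u U (𝓝 μ)) :
    mutualEnergy R μ μ ≤
      ENNReal.ofReal (Real.log R - Real.log (transfiniteDiameter F).toReal) := by
  have hctop := transfiniteDiameter_ne_top hFR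
  have hR0 : 0 < R := by linarith
  have hnull := compl_null_of_tendsto hlam hS.taut hU hu hμ
  have hmem := ae_prod_mem hnull hnull
  let δ : ℕ → ℝ := fun k => 1 / ((k : ℝ) + 1)
  have hδ : ∀ k, 0 < δ k := fun k => by positivity
  have hδ1 : ∀ k, δ k ≤ 1 := fun k => by
    rw [div_le_one (by positivity)]
    linarith [(Nat.cast_nonneg k : (0 : ℝ) ≤ k)]
  have hδlim : Tendsto δ atTop (𝓝 0) := tendsto_one_div_add_atTop_nhds_zero_nat
  let f : ℕ → ℂ × ℂ → ℝ≥0∞ := fun k p =>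
    ENNReal.ofReal (Real.log R - Real.log (max (dist p.1 p.2) (δ k)))
  have hbound : ∀ k, ∫⁻ p, f k p ∂((μ : Measure ℂ).prod (μ : Measure ℂ)) ≤
      ENNReal.ofReal (Real.log R - Real.log (transfiniteDiameter F).toReal) := by
    intro k
    have hi := (truncKernelBCF hlam (hδ k) (hδ1 k)).integrable
      ((μ : Measure ℂ).prod (μ : Measure ℂ))
    have heq : ∀ᵐ p ∂((μ : Measure ℂ).prod (μ : Measure ℂ)),
        0 ≤ Real.log R + truncKernel lam (δ k) p ∧
        f k p = ENNReal.ofReal (Real.log R + truncKernel lam (δ k) p) := by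
      filter_upwards [hmem] with p hp
      -- On $F$ the function $\lambda$ vanishes and the cutoff is inactive; adding $\log R$ then
      -- makes the integrand nonnegative.
      have e : truncKernel lam (δ k) p = -Real.log (max (dist p.1 p.2) (δ k)) := by
        rw [truncKernel, hlam.eq_zero _ hp.1, hlam.eq_zero _ hp.2, add_zero, zero_sub]
        exact min_eq_right (neg_le_neg (Real.log_le_log (hδ k) (le_max_right _ _)))
      rw [e, ← sub_eq_add_neg]
      refine ⟨sub_nonneg.2 (Real.log_le_log (lt_max_of_lt_right (hδ k)) ?_), rfl⟩
      exact max_le (hFR _ hp.1 _ hp.2) ((hδ1 k).trans hR)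
    have hi' : Integrable (fun p => Real.log R + truncKernel lam (δ k) p)
        ((μ : Measure ℂ).prod (μ : Measure ℂ)) := (integrable_const _).add hi
    rw [lintegral_congr_ae (heq.mono fun p hp => hp.2),
      ← ofReal_integral_eq_lintegral_ofReal hi' (heq.mono fun p hp => hp.1)]
    refine ENNReal.ofReal_le_ofReal ?_
    have e : ∫ p, (Real.log R + truncKernel lam (δ k) p)
        ∂((μ : Measure ℂ).prod (μ : Measure ℂ)) = Real.log R +
          ∫ p, truncKernel lam (δ k) p ∂((μ : Measure ℂ).prod (μ : Measure ℂ)) := by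
      refine (integral_add (integrable_const _) hi).trans ?_
      simp only [integral_const, probReal_univ, one_smul]
      rfl
    have := integral_truncKernel_le hc hctop hlam hS hU hu hμ (hδ k) (hδ1 k)
    exact e.trans_le (by linarith)
  have hlim : ∀ p : ℂ × ℂ, Tendsto (fun k => f k p) atTop (𝓝 (logKernel R p.1 p.2)) := by
    rintro ⟨x, y⟩
    rcases eq_or_ne x y with rfl | hxy
    · rw [logKernel_self]
      have h1 : ∀ k, f k (x, x) = ENNReal.ofReal (Real.log R - Real.log (δ k)) := fun k => by
        simp only [f, dist_self, max_eq_right (hδ k).le]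
      simp_rw [h1]
      refine ENNReal.tendsto_ofReal_atTop.comp ?_
      refine tendsto_atTop_add_const_left _ _ (tendsto_neg_atBot_atTop.comp ?_)
      exact Real.tendsto_log_nhdsGT_zero.comp
        (tendsto_nhdsWithin_iff.2 ⟨hδlim, Eventually.of_forall hδ⟩)
    · rw [logKernel_of_ne hR0 hxy]
      -- The sequence is constant once $\delta_k<|x-y|$.
      refine tendsto_const_nhds.congr' ?_
      filter_upwards [hδlim.eventually (gt_mem_nhds (dist_pos.2 hxy))] with k hk
      simp only [f, max_eq_left hk.le]
  have hmeas : ∀ k, Measurable (f k) := fun k => by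
    simp only [f]
    fun_prop
  -- The bound `hbound` does not depend on $k$, so Fatou's lemma passes it to the limit kernel.
  rw [mutualEnergy_eq_lintegral_prod]
  calc ∫⁻ p, logKernel R p.1 p.2 ∂((μ : Measure ℂ).prod (μ : Measure ℂ))
      = ∫⁻ p, liminf (fun k => f k p) atTop ∂((μ : Measure ℂ).prod (μ : Measure ℂ)) :=
        lintegral_congr fun p => (hlim p).liminf_eq.symm
    _ ≤ liminf (fun k => ∫⁻ p, f k p ∂((μ : Measure ℂ).prod (μ : Measure ℂ))) atTop :=
        lintegral_liminf_le hmeas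
    _ ≤ _ := by
        refine liminf_le_of_frequently_le' (Frequently.of_forall hbound)

end Limit

/-! ### Tightness -/

/-- The uniform measures of a taut sequence form a tight set. -/
lemma isTightMeasureSet_of_isTaut {F : Set ℂ} {lam : ℂ → ℝ} {S : ℕ → Finset ℂ}
    (hlam : IsLogDistance F lam) (hS : IsTaut lam S)
    (hcard : Tendsto (fun n => (S n).card) atTop atTop)
    {u : ℕ → ProbabilityMeasure ℂ}
    (hu : ∀ᶠ n in atTop, (u n : Measure ℂ) = uniformMeasure (S n)) :
    IsTightMeasureSet (Set.range fun n => (u n : Measure ℂ)) := by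
  obtain ⟨C, hC⟩ := hlam.bounded
  refine isTightMeasureSet_range_of_tendsto_limsup_measure_norm_gt ?_
  have hM : Tendsto (fun r : ℝ => Real.log r - C) atTop atTop :=
    tendsto_atTop_add_const_right _ _ Real.tendsto_log_atTop
  have hev : ∀ᶠ r : ℝ in atTop, limsup (fun n => (u n : Measure ℂ) {x | r < ‖x‖}) atTop ≤
      ENNReal.ofReal (Real.log r - C)⁻¹ := by
    filter_upwards [hM.eventually_gt_atTop 0, eventually_gt_atTop 0] with r hr hr0
    refine limsup_le_of_le (by isBoundedDefault) ?_
    filter_upwards [hu, hcard.eventually_ge_atTop 1, hS.eventually_lt_const one_pos]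
      with n hn hn1 hn2
    have hp := isProbabilityMeasure_uniformMeasure (S := S n) (by omega)
    -- Markov's inequality for $\lambda$, which exceeds $\log r-C$ outside the disc of radius $r$
    -- and eventually has average below 1.
    have hmk := mul_meas_ge_le_integral_of_nonneg (μ := uniformMeasure (S n))
      (ae_of_all _ hlam.nonneg) (integrable_uniformMeasure (by omega) lam) (Real.log r - C)
    rw [integral_uniformMeasure] at hmk
    have hsub : {x : ℂ | r < ‖x‖} ⊆ {x | Real.log r - C ≤ lam x} := by
      intro x hx
      have h1 : Real.log r ≤ Real.posLog ‖x‖ :=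
        (Real.log_le_log hr0 (le_of_lt hx)).trans (le_max_right _ _)
      have h2 := (abs_le.1 (hC x)).1
      change Real.log r - C ≤ lam x
      linarith
    rw [hn, ← ofReal_measureReal]
    refine ENNReal.ofReal_le_ofReal ((measureReal_mono hsub).trans ?_)
    rw [← one_div, le_div_iff₀' hr]
    linarith
  have hlim : Tendsto (fun r : ℝ => ENNReal.ofReal (Real.log r - C)⁻¹) atTop (𝓝 0) := by
    simpa using ENNReal.tendsto_ofReal (tendsto_inv_atTop_zero.comp hM)
  exact tendsto_of_tendsto_of_tendsto_of_le_of_le' tendsto_const_nhds hlim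
    (Eventually.of_forall fun _ => zero_le) hev

end LogPotential

end

/-! ### Compactness and conclusion -/

theorem mainTheorem4 (F : Set ℂ) (hF : IsCompact F)
    (hc : 0 < LogPotential.transfiniteDiameter F)
    (lam : ℂ → ℝ) (hlam : LogPotential.IsLogDistance F lam)
    (S : ℕ → Finset ℂ) (hS : LogPotential.IsPseudoEquidistributed F lam S) :
    (∃! μ : MeasureTheory.Measure ℂ, LogPotential.IsEquilibriumMeasure F μ) ∧
      ∀ μ : MeasureTheory.Measure ℂ, LogPotential.IsEquilibriumMeasure F μ →
        LogPotential.IsEquidistributed S μ := by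
  open MeasureTheory Filter Topology LogPotential in
  obtain ⟨R₀, hR₀⟩ := Metric.isBounded_iff.1 hF.isBounded
  let R := max R₀ 1
  have hR : 1 ≤ R := le_max_right _ _
  have hFR : ∀ x ∈ F, ∀ y ∈ F, dist x y ≤ R := fun x hx y hy =>
    (hR₀ hx hy).trans (le_max_left _ _)
  -- The point mass at 0 is a filler for empty $S_n$, which occur only finitely often.
  let u : ℕ → ProbabilityMeasure ℂ := fun n =>
    if h : (S n).card ≠ 0 then ⟨uniformMeasure (S n), isProbabilityMeasure_uniformMeasure h⟩
    else ⟨Measure.dirac 0, inferInstance⟩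
  have hu : ∀ᶠ n in atTop, (u n : Measure ℂ) = uniformMeasure (S n) := by
    filter_upwards [hS.fekete.card.eventually_ge_atTop 1] with n hn
    have hn' : (S n).card ≠ 0 := by omega
    have : u n = ⟨uniformMeasure (S n), isProbabilityMeasure_uniformMeasure hn'⟩ := dif_pos hn'
    rw [this]
    rfl
  have hK : IsCompact (closure (Set.range u)) := by
    refine isCompact_closure_of_isTightMeasureSet ?_
    have := isTightMeasureSet_of_isTaut hlam hS.taut hS.fekete.card hu
    convert this using 1
    ext ν
    simp
  have hmem : ∀ n, u n ∈ closure (Set.range u) := fun n => subset_closure ⟨n, rfl⟩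
  have hcluster : ∀ μ : ProbabilityMeasure ℂ, MapClusterPt μ atTop u →
      IsEquilibriumMeasure F (μ : Measure ℂ) ∧ mutualEnergy R μ μ ≠ ⊤ := by
    intro μ hμ
    obtain ⟨U, hU, hUμ⟩ := mapClusterPt_iff_ultrafilter.1 hμ
    have hle := mutualEnergy_le_of_tendsto hc hR hFR hlam hS hU hu hUμ
    have hnull := compl_null_of_tendsto hlam hS.taut hU hu hUμ
    refine ⟨⟨inferInstance, hnull, fun ν hν hν0 => ?_⟩,
      ne_top_of_le_ne_top ENNReal.ofReal_ne_top hle⟩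
    -- The upper bound for limits meets the lower bound for all competitors.
    exact (energy_le_energy_iff hR hFR hnull hν0).2
      (hle.trans (ofReal_log_sub_log_le_mutualEnergy hR hFR hc hν0))
  -- Existence of the equilibrium measure comes from the sequence itself: any cluster point is one.
  obtain ⟨μ₀, -, hμ₀⟩ := hK.exists_mapClusterPt (f := atTop) (u := u)
    (le_principal_iff.2 (mem_map.2 (Filter.univ_mem' hmem)))
  obtain ⟨heq, hfin⟩ := hcluster μ₀ hμ₀
  have huniq : ∀ μ, IsEquilibriumMeasure F μ → μ = (μ₀ : Measure ℂ) := fun μ hμ =>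
    (heq.eq_of_mutualEnergy_ne_top hR hFR hμ hfin).symm
  refine ⟨⟨μ₀, heq, huniq⟩, fun μ hμ => ?_⟩
  rw [huniq μ hμ]
  have hlim : Tendsto u atTop (𝓝 μ₀) :=
    hK.tendsto_nhds_of_unique_mapClusterPt (Eventually.of_forall hmem) fun μ _ hμ =>
      Subtype.ext (huniq _ (hcluster μ hμ).1)
  intro f
  refine (ProbabilityMeasure.tendsto_iff_forall_integral_tendsto.1 hlim f).congr' ?_
  filter_upwards [hu] with n hn
  rw [hn]
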